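/- Let $n\ge 1$ and consider on $\mathbb{R}^n\times[0,\infty)$ the system $$\dot x=f(x,t)+B_1(x,t)u+B_2(x,t)d(t),\qquad f(x,t)=A(x,t)x,$$ with $x\in\mathbb{R}^n$, $u\in\mathbb{R}^m$, $d(t)\in\mathbb{R}^k$, $\bar d=\sup_{t\ge0}\|d(t)\|<\infty$ and $\|B_2(x,t)\|\le\bar b_2$ for all $x$ and $t\ge0$, where $\bar b_2>0$; let $\alpha,\lambda>0$. For a differentiable matrix function $W(x,t)\succ0$ put $M=W^{-1}$; the feedback of $W$ is $u=-B_1^TMx$. In the constraints below, $\dot W=\partial W/\partial t+(\partial W/\partial x)\,\dot x$ is the total derivative along $\dot x=f+B_1u+B_2d$, where $u$ is either the feedback of $W$ itself, or an input law $u(x,t)$ that is prescribed independently of $W$ (as for trajectories computed beforehand), or more generally any input law assigned to $W$. Fix one such choice. Call $(\underline\omega,\overline\omega,W)$ feasible if $\underline\omega,\overline\omega>0$ and, for all $x$ and all $t\ge0$, $W\succ0$ and $$\dot W-AW-WA^T+2B_1B_1^T\succeq2\alpha W,\qquad \underline\omega I\preceq W\preceq\overline\omega I .$$ (1) Let $(\underline\omega,\overline\omega,W)$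 be feasible and let $x(t)$, $t\ge0$, be a solution of the closed loop with $u=-B_1^TMx$, along which the input law used in $\dot W$ agrees with this feedback. Let $\int_0^{x}\|\delta q\|$ denote the smallest path integral from $0$ to $x$ (the infimum over $C^1$ paths), and let $R_c(0)=\int_0^{x(0)}\|\Theta\,\delta q\|$ be the smallest path integral for a matrix $\Theta$ with $M(x(0),0)=\Theta^T\Theta$. Then, with $\chi=\overline\omega/\underline\omega$, $$\int_0^{x(t)}\|\delta q\|\le\sqrt{\overline\omega}\,R_c(0)\,e^{-\alpha t}+\frac{\bar b_2\bar d}{\alpha}\chi\quad(t\ge0),\qquad \limsup_{t\to\infty}\int_0^{x(t)}\|\delta q\|\le\frac{\bar b_2\bar d}{\alpha}\chi .$$ (2) The problem of minimizing this bound plus a penalty, $\frac{\bar b_2\bar d}{\alpha}\frac{\overline\omega}{\underline\omega}+\frac{\lambda}{\underline\omega}$, over the feasible $(\underline\omega,\overline\omega,W)$ is equivalent to the program $$\min_{\nu>0,\ \chi\in\mathbb{R},\ \tilde W\succ0}\ \frac{\bar b_2\bar d}{\alpha}\chi+\lambda\nu\quad\text{s.t. } -\dot{\tilde W}+A\tilde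 W+\tilde WA^T-2\nu B_1B_1^T\preceq-2\alpha\tilde W,\quad I\preceq\tilde W\preceq\chi I\quad\text{for all }x,\ t\ge0,$$ under $\chi=\overline\omega/\underline\omega$, $\nu=1/\underline\omega$, $\tilde W=\nu W$ (the dot of $\tilde W$ being taken along the same motion as that of $W=\nu^{-1}\tilde W$): the two optimal values (infima) coincide, and the optimal solutions of either problem, if there are any, are carried to those of the other by this substitution and its inverse. (3) When the input law used in the dot is prescribed independently of the metric, the program in $(\nu,\chi,\tilde W)$ is convex: its feasible set is convex and its objective is a convex function on it. -/

import Mathlib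

open Set Filter Topology
open scoped Matrix Matrix.Norms.L2Operator

noncomputable section

/-- `ℝⁿ` with the Euclidean norm. -/
abbrev Eucl (n : ℕ) : Type := EuclideanSpace ℝ (Fin n)

/-- Matrix-valued functions `W(x,t)`; only the values at times `t ≥ 0` matter. -/
abbrev MetricField (n : ℕ) : Type := Eucl n → ℝ → Matrix (Fin n) (Fin n) ℝ

/-- The product of a matrix and a vector, as a vector of Euclidean space. -/
def mulE {a b : ℕ} (P : Matrix (Fin a) (Fin b) ℝ) (v : Eucl b) : Eucl a :=
  WithLp.toLp 2 (P *ᵥ v.ofLp)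

/-- The path integral `∫ ‖Θ δq‖` along the path `γ : [0,1] → ℝⁿ`. -/
def pathIntegral {n : ℕ} (Θ : Matrix (Fin n) (Fin n) ℝ) (γ : ℝ → Eucl n) : ℝ :=
  ∫ μ in (0 : ℝ)..1, ‖mulE Θ (derivWithin γ (Icc 0 1) μ)‖

/-- The smallest path integral `∫_a^b ‖Θ δq‖`: the infimum over all `C¹` paths from `a` to `b`. -/
def smallestPathIntegral {n : ℕ} (Θ : Matrix (Fin n) (Fin n) ℝ) (a b : Eucl n) : ℝ :=
  sInf {L : ℝ | ∃ γ : ℝ → Eucl n, ContDiffOn ℝ 1 γ (Icc 0 1) ∧ γ 0 = a ∧ γ 1 = b ∧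
    L = pathIntegral Θ γ}

/-- The space-time domain `ℝⁿ × [0,∞)`. -/
def spaceTime (n : ℕ) : Set (Eucl n × ℝ) := univ ×ˢ Ici (0 : ℝ)

/-- `W` is differentiable on `ℝⁿ × [0,∞)` (one-sided in time at `t = 0`). -/
def MetricField.IsDiff {n : ℕ} (W : MetricField n) : Prop :=
  DifferentiableOn ℝ (fun p : Eucl n × ℝ => W p.1 p.2) (spaceTime n)

/-- The total time derivative `Ẇ(x,t) = ∂W/∂t + ∂W/∂x · v(x,t)` along the motion `ẋ = v(x,t)`. -/
def MetricField.dot {n : ℕ} (W : MetricField n) (v : Eucl n → ℝ → Eucl n) : MetricField n :=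
  fun x t => fderivWithin ℝ (fun p : Eucl n × ℝ => W p.1 p.2) (spaceTime n) (x, t) (v x t, 1)

/-- The data of the control system `ẋ = f(x,t) + B₁(x,t) u + B₂(x,t) d(t)`, together with a
state-dependent coefficient form `f(x,t) = A(x,t) x` of the drift (so that `f(0,t) = 0`). -/
structure ControlSystem (n m k : ℕ) where
  f : Eucl n → ℝ → Eucl n
  A : Eucl n → ℝ → Matrix (Fin n) (Fin n) ℝ
  B₁ : Eucl n → ℝ → Matrix (Fin n) (Fin m) ℝ
  B₂ : Eucl n → ℝ → Matrix (Fin n) (Fin k) ℝ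
  d : ℝ → Eucl k
  A_mul : ∀ x t, 0 ≤ t → mulE (A x t) x = f x t

namespace ControlSystem

variable {n m k : ℕ} (S : ControlSystem n m k)

/-- The right-hand side `f(x,t) + B₁(x,t) u(x,t) + B₂(x,t) d(t)` under the input law `u`. -/
def velocity (u : Eucl n → ℝ → Eucl m) : Eucl n → ℝ → Eucl n :=
  fun x t => S.f x t + mulE (S.B₁ x t) (u x t) + mulE (S.B₂ x t) (S.d t)

/-- The state feedback `u = -B₁(x,t)ᵀ M(x,t) x` with `M = W⁻¹`. -/
def feedback (W : MetricField n) : Eucl n → ℝ → Eucl m :=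
  fun x t => -mulE (S.B₁ x t)ᵀ (mulE (W x t)⁻¹ x)

/-- `x` is a solution on `[0,∞)` of the system in closed loop with `u = -B₁ᵀ W⁻¹ x`. -/
def IsClosedLoopSolution (W : MetricField n) (x : ℝ → Eucl n) : Prop :=
  ∀ t, 0 ≤ t → HasDerivWithinAt x (S.velocity (S.feedback W) (x t) t) (Ici 0) t

/-- The feasible triples `(ω₁, ω₂, W)`: `0 < ω₁, ω₂`, `W ≻ 0`, `ω₁ I ⪯ W ⪯ ω₂ I` and
`Ẇ - A W - W Aᵀ + 2 B₁ B₁ᵀ ⪰ 2 α W` for all `x` and all `t ≥ 0`, where the dot is taken along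
`ẋ = f + B₁ u + B₂ d` with the input law `u = U W`. The choice `U = S.feedback` is the closed loop
of `W` itself; a constant `U` is an input law that is prescribed beforehand. -/
def metricFeasible (α : ℝ) (U : MetricField n → Eucl n → ℝ → Eucl m) :
    Set (ℝ × ℝ × MetricField n) :=
  {p | match p with
    | (ω₁, ω₂, W) => 0 < ω₁ ∧ 0 < ω₂ ∧ W.IsDiff ∧ ∀ x t, 0 ≤ t →
        (W x t).PosDef ∧
        (W x t - ω₁ • (1 : Matrix (Fin n) (Fin n) ℝ)).PosSemidef ∧
        (ω₂ • (1 : Matrix (Fin n) (Fin n) ℝ) - W x t).PosSemidef ∧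
        ((W.dot (S.velocity (U W)) x t - S.A x t * W x t - W x t * (S.A x t)ᵀ
            + (2 : ℝ) • (S.B₁ x t * (S.B₁ x t)ᵀ)) - (2 * α) • W x t).PosSemidef}

/-- The feasible triples `(ν, χ, V)` of the convex program, `V` standing for `W̃ = ν W`:
`0 < ν`, `V ≻ 0`, `I ⪯ V ⪯ χ I` and `-V̇ + A V + V Aᵀ - 2 ν B₁ B₁ᵀ ⪯ -2 α V` for all `x` and all
`t ≥ 0`, where the dot is taken along `ẋ = f + B₁ u + B₂ d` with `u = U W`, `W = ν⁻¹ V`. -/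
def convexFeasible (α : ℝ) (U : MetricField n → Eucl n → ℝ → Eucl m) :
    Set (ℝ × ℝ × MetricField n) :=
  {q | match q with
    | (ν, χ, V) => 0 < ν ∧ V.IsDiff ∧ ∀ x t, 0 ≤ t →
        (V x t).PosDef ∧
        (V x t - (1 : Matrix (Fin n) (Fin n) ℝ)).PosSemidef ∧
        (χ • (1 : Matrix (Fin n) (Fin n) ℝ) - V x t).PosSemidef ∧
        (-((2 * α) • V x t) - (-V.dot (S.velocity (U (ν⁻¹ • V))) x t + S.A x t * V x t
            + V x t * (S.A x t)ᵀ - (2 * ν) • (S.B₁ x t * (S.B₁ x t)ᵀ))).PosSemidef}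

end ControlSystem

/-- The steady-state bound plus penalty, in terms of `(ω₁, ω₂, W)`. -/
def metricCost {n : ℕ} (α b₂ dbar lam : ℝ) (p : ℝ × ℝ × MetricField n) : ℝ :=
  b₂ * dbar / α * (p.2.1 / p.1) + lam * (1 / p.1)

/-- The objective of the convex program, in terms of `(ν, χ, V)`. -/
def convexCost {n : ℕ} (α b₂ dbar lam : ℝ) (q : ℝ × ℝ × MetricField n) : ℝ :=
  b₂ * dbar / α * q.2.1 + lam * q.1

/-- `p` is an optimal solution of the problem of minimizing `J` over `F`. -/
def IsOptimal {X : Type*} (J : X → ℝ) (F : Set X) (p : X) : Prop :=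
  p ∈ F ∧ ∀ q ∈ F, J p ≤ J q

/-- The optimal value of the problem of minimizing `J` over `F` (`+∞` if `F` is empty). -/
def optimalValue {X : Type*} (J : X → ℝ) (F : Set X) : EReal :=
  ⨅ p ∈ F, (J p : EReal)

end

/-! Put `y = W⁻¹x` and follow the energy `E = xᵀW⁻¹x = yᵀWy` along a closed-loop solution. Since
`(W⁻¹)˙ = -W⁻¹ẆW⁻¹`, one has `E' = 2y·ẋ - yᵀẆy`. Testing the matrix inequality on `y`, where `AWy =
Ax`, bounds all terms but the disturbance: `E' ≤ -2αE + 2y·B₂d`. From `W ⪰ ω₁I` comes `‖y‖ ≤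
√(E/ω₁)`, so `√E` decays at rate `α` down to `b₂ dbar/(α√ω₁)` (`sqrt_le_of_hasDerivWithinAt_le`).
From `W ⪯ ω₂I` comes `‖x‖ ≤ √(ω₂E)`, which gives the bound with `√(ω₂/ω₁) ≤ ω₂/ω₁`. For a constant
`Θ` straight segments are shortest, so the path integrals are the norms `‖x‖` and `‖Θx‖`.

The equivalence is a rescaling: multiplying the constraints by `ν = 1/ω₁` turns one feasible set
into the other at equal cost, because the dot is linear in the metric once the velocity is fixed.
With a prescribed input the velocity does not depend on the metric, so the constraints are affine in
`(ν, χ, V)` and the program is convex. -/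

section MulE

variable {a b c : ℕ}

/-- `mulE` as a continuous bilinear map. -/
noncomputable def mulEBilin (a b : ℕ) :
    Matrix (Fin a) (Fin b) ℝ →L[ℝ] Eucl b →L[ℝ] Eucl a :=
  LinearMap.toContinuousLinearMap
    ((Matrix.toEuclideanLin ≪≫ₗ LinearMap.toContinuousLinearMap).toLinearMap)

theorem mulEBilin_apply (P : Matrix (Fin a) (Fin b) ℝ) (v : Eucl b) :
    mulEBilin a b P v = mulE P v := rfl

theorem mulE_add_left (P Q : Matrix (Fin a) (Fin b) ℝ) (v : Eucl b) :
    mulE (P + Q) v = mulE P v + mulE Q v := by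
  simp [← mulEBilin_apply]

theorem mulE_sub_left (P Q : Matrix (Fin a) (Fin b) ℝ) (v : Eucl b) :
    mulE (P - Q) v = mulE P v - mulE Q v := by
  simp [← mulEBilin_apply]

theorem mulE_neg_left (P : Matrix (Fin a) (Fin b) ℝ) (v : Eucl b) :
    mulE (-P) v = -mulE P v := by
  simp [← mulEBilin_apply]

theorem mulE_smul_left (r : ℝ) (P : Matrix (Fin a) (Fin b) ℝ) (v : Eucl b) :
    mulE (r • P) v = r • mulE P v := by
  simp [← mulEBilin_apply]

theorem mulE_neg_right (P : Matrix (Fin a) (Fin b) ℝ) (v : Eucl b) :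
    mulE P (-v) = -mulE P v := by
  simp [← mulEBilin_apply]

theorem mulE_zero_right (P : Matrix (Fin a) (Fin b) ℝ) : mulE P (0 : Eucl b) = 0 := by
  simp [← mulEBilin_apply]

theorem mulE_mul (P : Matrix (Fin a) (Fin b) ℝ) (Q : Matrix (Fin b) (Fin c) ℝ) (v : Eucl c) :
    mulE (P * Q) v = mulE P (mulE Q v) := by
  simp [mulE]

theorem mulE_one (v : Eucl a) : mulE (1 : Matrix (Fin a) (Fin a) ℝ) v = v := by
  simp [mulE]

theorem inner_mulE_left (P : Matrix (Fin a) (Fin b) ℝ) (v : Eucl b) (w : Eucl a) :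
    inner ℝ (mulE P v) w = inner ℝ v (mulE Pᵀ w) := by
  simp only [mulE, EuclideanSpace.inner_eq_star_dotProduct, star_trivial,
    Matrix.mulVec_transpose, Matrix.dotProduct_mulVec]

theorem norm_mulE_le (P : Matrix (Fin a) (Fin b) ℝ) (v : Eucl b) :
    ‖mulE P v‖ ≤ ‖P‖ * ‖v‖ :=
  Matrix.l2_opNorm_mulVec P v

theorem _root_.Matrix.PosSemidef.inner_mulE_nonneg {P : Matrix (Fin a) (Fin a) ℝ}
    (hP : P.PosSemidef) (v : Eucl a) : 0 ≤ inner ℝ v (mulE P v) := by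
  have := hP.dotProduct_mulVec_nonneg v.ofLp
  rw [EuclideanSpace.inner_eq_star_dotProduct]
  simpa [mulE, dotProduct_comm] using this

end MulE

/-! ### Shortest paths for a constant metric -/

section PathIntegral

variable {n : ℕ}

/-- The integral of `Θγ'` is `Θγ(1) - Θγ(0)`, and the norm of an integral is at most the integral of
the norm. -/
theorem norm_mulE_sub_le_pathIntegral (Θ : Matrix (Fin n) (Fin n) ℝ) {γ : ℝ → Eucl n}
    (hγ : ContDiffOn ℝ 1 γ (Icc 0 1)) :
    ‖mulE Θ (γ 1) - mulE Θ (γ 0)‖ ≤ pathIntegral Θ γ := by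
  have hc : ContinuousOn (fun μ => mulE Θ (derivWithin γ (Icc 0 1) μ)) (Icc 0 1) :=
    (mulEBilin n n Θ).continuous.comp_continuousOn
      (hγ.continuousOn_derivWithin (uniqueDiffOn_Icc zero_lt_one) le_rfl)
  have hint : ∫ μ in (0 : ℝ)..1, mulE Θ (derivWithin γ (Icc 0 1) μ) =
      mulE Θ (γ 1) - mulE Θ (γ 0) := by
    refine intervalIntegral.integral_eq_sub_of_hasDerivAt_of_le (f := fun μ => mulE Θ (γ μ))
      zero_le_one ((mulEBilin n n Θ).continuous.comp_continuousOn hγ.continuousOn)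
      (fun μ hμ => ?_) (hc.intervalIntegrable_of_Icc zero_le_one)
    have h := (hγ.differentiableOn one_ne_zero μ (Ioo_subset_Icc_self hμ)).hasDerivWithinAt
    exact (mulEBilin n n Θ).hasFDerivAt.comp_hasDerivAt μ
      (h.hasDerivAt (Icc_mem_nhds hμ.1 hμ.2))
  rw [← hint]
  exact intervalIntegral.norm_integral_le_integral_norm zero_le_one

theorem pathIntegral_segment (Θ : Matrix (Fin n) (Fin n) ℝ) (x : Eucl n) :
    pathIntegral Θ (fun μ => μ • x) = ‖mulE Θ x‖ := by
  have h : ∀ μ ∈ uIcc (0 : ℝ) 1,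
      ‖mulE Θ (derivWithin (fun μ : ℝ => μ • x) (Icc 0 1) μ)‖ = ‖mulE Θ x‖ := by
    intro μ hμ
    rw [uIcc_of_le zero_le_one] at hμ
    have hd : HasDerivWithinAt (fun μ : ℝ => μ • x) x (Icc 0 1) μ := by
      simpa using ((hasDerivAt_id μ).smul_const x).hasDerivWithinAt
    rw [hd.derivWithin (uniqueDiffOn_Icc zero_lt_one μ hμ)]
  rw [pathIntegral, intervalIntegral.integral_congr h]
  simp

/-- For a constant metric, the straight line is a shortest path. -/
theorem smallestPathIntegral_zero_left (Θ : Matrix (Fin n) (Fin n) ℝ) (x : Eucl n) :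
    smallestPathIntegral Θ 0 x = ‖mulE Θ x‖ := by
  refine IsLeast.csInf_eq ⟨⟨fun μ => μ • x, ?_, by simp, by simp,
    (pathIntegral_segment Θ x).symm⟩, ?_⟩
  · exact (contDiff_id.smul contDiff_const).contDiffOn
  · rintro L ⟨γ, hγ, h0, h1, rfl⟩
    simpa [h0, h1, mulE_zero_right] using norm_mulE_sub_le_pathIntegral Θ hγ

end PathIntegral

/-! ### A comparison lemma and the derivative of the inverse -/

/-- If `V' ≤ -2αV + 2c√V`, then `√V` decays exponentially up to `c/α`. -/
theorem sqrt_le_of_hasDerivWithinAt_le {V V' : ℝ → ℝ} {α c : ℝ} (hα : 0 < α) (hc : 0 ≤ c)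
    (hV : ∀ t, 0 ≤ t → 0 ≤ V t)
    (hd : ∀ t, 0 ≤ t → HasDerivWithinAt V (V' t) (Ici 0) t)
    (hle : ∀ t, 0 ≤ t → V' t ≤ -(2 * α) * V t + 2 * c * √(V t)) {t : ℝ} (ht : 0 ≤ t) :
    √(V t) ≤ √(V 0) * Real.exp (-α * t) + c / α := by
  refine le_of_forall_pos_le_add fun ε hε => ?_
  obtain ⟨δ, hδ, hδε⟩ : ∃ δ : ℝ, 0 < δ ∧ 2 * δ = ε := ⟨ε / 2, by positivity, by ring⟩
  have hpos : ∀ s, 0 ≤ s → 0 < V s + δ ^ 2 := fun s hs => by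
    have := hV s hs
    positivity
  -- `√V` need not be differentiable where `V = 0`, so it is regularised to `R = √(V + δ²)`. This
  -- satisfies `R' ≤ -αR + αδ + c`, whose equilibrium is `δ + c/α`; hence `F` is nonincreasing.
  set F : ℝ → ℝ := fun s => Real.exp (α * s) * (√(V s + δ ^ 2) - (δ + c / α)) with hF
  set F' : ℝ → ℝ := fun s => Real.exp (α * s) * α * (√(V s + δ ^ 2) - (δ + c / α)) +
    Real.exp (α * s) * (V' s / (2 * √(V s + δ ^ 2))) with hF'
  have hFd : ∀ s, 0 ≤ s → HasDerivWithinAt F (F' s) (Ici 0) s := by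
    intro s hs
    have h1 : HasDerivWithinAt (fun s => Real.exp (α * s)) (Real.exp (α * s) * α) (Ici 0) s := by
      simpa using (((hasDerivAt_id s).const_mul α).exp).hasDerivWithinAt
    have h2 := (((hd s hs).add_const (δ ^ 2)).sqrt (hpos s hs).ne').sub_const (δ + c / α)
    exact h1.mul h2
  have hanti : AntitoneOn F (Ici 0) := by
    refine antitoneOn_of_hasDerivWithinAt_nonpos (f' := F') (convex_Ici 0)
      (fun s hs => (hFd s hs).continuousWithinAt) (fun s hs => ?_) (fun s hs => ?_)
    · exact (hFd s (interior_subset hs)).mono interior_subset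
    · have hs0 : 0 ≤ s := interior_subset hs
      set R := √(V s + δ ^ 2) with hR
      have hRpos : 0 < R := Real.sqrt_pos.2 (hpos s hs0)
      have hRsq : R ^ 2 = V s + δ ^ 2 := Real.sq_sqrt (hpos s hs0).le
      have hRδ : δ ≤ R := Real.le_sqrt_of_sq_le (by linarith [hV s hs0])
      have hVR : √(V s) ≤ R := Real.sqrt_le_sqrt (by linarith [sq_nonneg δ])
      -- Substitute `V = R² - δ²` and `√V ≤ R`, then divide by `2R`; the leftover `αδ²/R` is at most
      -- `αδ` since `δ ≤ R`.
      have h2 : V' s / (2 * R) ≤ -α * R + α * δ + c := by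
        rw [div_le_iff₀ (by positivity)]
        have e1 := mul_le_mul_of_nonneg_left hVR hc
        have e2 := mul_le_mul_of_nonneg_left hRδ (mul_nonneg hα.le hδ.le)
        have e3 := hle s hs0
        have e4 : α * V s = α * R ^ 2 - α * δ ^ 2 := by rw [hRsq]; ring
        nlinarith
      have h3 : F' s = Real.exp (α * s) * (α * R - α * δ - c + V' s / (2 * R)) := by
        simp only [hF', ← hR]
        field_simp
        ring
      rw [h3]
      exact mul_nonpos_of_nonneg_of_nonpos (Real.exp_pos _).le (by linarith)
  have h0 := hanti (mem_Ici.2 le_rfl) (mem_Ici.2 ht) ht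
  simp only [hF, mul_zero, Real.exp_zero, one_mul] at h0
  have hE : Real.exp (-α * t) * Real.exp (α * t) = 1 := by
    rw [← Real.exp_add]
    simp
  have hE1 : Real.exp (-α * t) ≤ 1 := Real.exp_le_one_iff.2 (by nlinarith)
  have hEpos := Real.exp_pos (-α * t)
  have h1 := mul_le_mul_of_nonneg_left h0 hEpos.le
  rw [← mul_assoc, hE, one_mul] at h1
  have h2 : √(V t) ≤ √(V t + δ ^ 2) := Real.sqrt_le_sqrt (by linarith [sq_nonneg δ])
  have h3 : √(V 0 + δ ^ 2) ≤ √(V 0) + δ := by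
    refine Real.sqrt_le_iff.2 ⟨by positivity, ?_⟩
    nlinarith [Real.sq_sqrt (hV 0 le_rfl), mul_nonneg (Real.sqrt_nonneg (V 0)) hδ.le]
  have h4 := mul_le_mul_of_nonneg_left h3 hEpos.le
  have h5 : 0 ≤ Real.exp (-α * t) * (c / α) := by positivity
  nlinarith

/-- The inverse of a differentiable curve of invertible matrices. -/
theorem HasDerivWithinAt.matrix_inv {n : ℕ} {N : ℝ → Matrix (Fin n) (Fin n) ℝ}
    {N' : Matrix (Fin n) (Fin n) ℝ} {s : Set ℝ} {t : ℝ} (h : HasDerivWithinAt N N' s t)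
    (hu : IsUnit (N t)) :
    HasDerivWithinAt (fun r => (N r)⁻¹) (-((N t)⁻¹ * N' * (N t)⁻¹)) s t := by
  obtain ⟨u, hu⟩ := hu
  have h1 := hasFDerivAt_ringInverse (𝕜 := ℝ) u
  rw [hu] at h1
  have h2 := h1.comp_hasDerivWithinAt t h
  simp only [Matrix.nonsing_inv_eq_ringInverse]
  refine h2.congr_deriv ?_
  rw [← hu]
  simp

/-! ### Linearity and chain rule for the total derivative -/

section Fields

variable {n : ℕ}

/-- Uniqueness of the derivative within the domain, including at `t = 0`, is what makes the dot
linear in the metric. -/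
theorem uniqueDiffOn_spaceTime (n : ℕ) : UniqueDiffOn ℝ (spaceTime n) :=
  uniqueDiffOn_univ.prod (uniqueDiffOn_Ici 0)

theorem mem_spaceTime {x : Eucl n} {t : ℝ} (ht : 0 ≤ t) : (x, t) ∈ spaceTime n :=
  ⟨mem_univ _, ht⟩

namespace MetricField

theorem IsDiff.add {V W : MetricField n} (hV : V.IsDiff) (hW : W.IsDiff) : (V + W).IsDiff :=
  DifferentiableOn.fun_add hV hW

theorem IsDiff.smul {W : MetricField n} (hW : W.IsDiff) (r : ℝ) : (r • W).IsDiff :=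
  DifferentiableOn.fun_const_smul hW r

theorem dot_add {V W : MetricField n} (hV : V.IsDiff) (hW : W.IsDiff)
    (v : Eucl n → ℝ → Eucl n) (x : Eucl n) {t : ℝ} (ht : 0 ≤ t) :
    (V + W).dot v x t = V.dot v x t + W.dot v x t := by
  have h := fderivWithin_fun_add (uniqueDiffOn_spaceTime n _ (mem_spaceTime (x := x) ht))
    (hV _ (mem_spaceTime ht)) (hW _ (mem_spaceTime ht))
  simpa [dot] using congrArg (fun L => L (v x t, (1 : ℝ))) h

theorem dot_smul {W : MetricField n} (hW : W.IsDiff) (r : ℝ)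
    (v : Eucl n → ℝ → Eucl n) (x : Eucl n) {t : ℝ} (ht : 0 ≤ t) :
    (r • W).dot v x t = r • W.dot v x t := by
  have h := fderivWithin_fun_const_smul (uniqueDiffOn_spaceTime n _ (mem_spaceTime (x := x) ht))
    (hW _ (mem_spaceTime ht)) r
  simpa [dot] using congrArg (fun L => L (v x t, (1 : ℝ))) h

/-- The total derivative is the derivative along a trajectory. -/
theorem IsDiff.hasDerivWithinAt_comp {W : MetricField n} (hW : W.IsDiff)
    {v : Eucl n → ℝ → Eucl n} {x : ℝ → Eucl n} {t : ℝ} (ht : 0 ≤ t)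
    (hx : HasDerivWithinAt x (v (x t) t) (Ici 0) t) :
    HasDerivWithinAt (fun s => W (x s) s) (W.dot v (x t) t) (Ici 0) t := by
  have h1 := (hW _ (mem_spaceTime (x := x t) ht)).hasFDerivWithinAt
  exact h1.comp_hasDerivWithinAt (f := fun s => (x s, s)) t
    (hx.prodMk (hasDerivWithinAt_id t _)) (fun s hs => mem_spaceTime hs)

end MetricField

end Fields

/-- The derivative of `xᵀ N⁻¹ x` along differentiable curves `x` and `N`. -/
theorem hasDerivWithinAt_inner_inv {n : ℕ} {N : ℝ → Matrix (Fin n) (Fin n) ℝ}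
    {N' : Matrix (Fin n) (Fin n) ℝ} {x : ℝ → Eucl n} {x' : Eucl n} {s : Set ℝ} {t : ℝ}
    (hN : HasDerivWithinAt N N' s t) (hx : HasDerivWithinAt x x' s t) (hu : IsUnit (N t))
    (hsymm : (N t)ᵀ = N t) :
    HasDerivWithinAt (fun r => inner ℝ (x r) (mulE (N r)⁻¹ (x r)))
      (2 * inner ℝ (mulE (N t)⁻¹ (x t)) x' -
        inner ℝ (mulE (N t)⁻¹ (x t)) (mulE N' (mulE (N t)⁻¹ (x t)))) s t := by
  have hM := (mulEBilin n n).hasFDerivAt.comp_hasDerivWithinAt t (hN.matrix_inv hu)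
  have h := hx.inner ℝ (hM.clm_apply hx)
  have hinv : ((N t)⁻¹)ᵀ = (N t)⁻¹ := by rw [Matrix.transpose_nonsing_inv, hsymm]
  refine h.congr_deriv ?_
  simp only [Function.comp_apply, mulEBilin_apply, mulE_neg_left, mulE_mul, inner_add_right,
    inner_neg_right]
  have hsa (z : Eucl n) : inner ℝ (x t) (mulE (N t)⁻¹ z) = inner ℝ (mulE (N t)⁻¹ (x t)) z := by
    rw [inner_mulE_left, hinv]
  rw [hsa, hsa, real_inner_comm _ x']
  ring

/-! ### The energy estimate for the closed loop -/

namespace ControlSystem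

variable {n m k : ℕ} {S : ControlSystem n m k} {α b₂ dbar : ℝ}
  {U : MetricField n → Eucl n → ℝ → Eucl m} {ω₁ ω₂ : ℝ} {W : MetricField n}

/-- The energy `xᵀ M x`, `M = W⁻¹`, of the displacement from the origin along a curve. -/
noncomputable def energy (W : MetricField n) (x : ℝ → Eucl n) (t : ℝ) : ℝ :=
  inner ℝ (x t) (mulE (W (x t) t)⁻¹ (x t))

theorem isUnit_of_mem_metricFeasible (hW : (ω₁, ω₂, W) ∈ S.metricFeasible α U) (x : Eucl n)
    {t : ℝ} (ht : 0 ≤ t) : IsUnit (W x t) :=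
  (hW.2.2.2 x t ht).1.isUnit

theorem transpose_of_mem_metricFeasible (hW : (ω₁, ω₂, W) ∈ S.metricFeasible α U) (x : Eucl n)
    {t : ℝ} (ht : 0 ≤ t) : (W x t)ᵀ = W x t := by
  simpa using (hW.2.2.2 x t ht).1.isHermitian.eq

theorem mulE_mulE_inv (hW : (ω₁, ω₂, W) ∈ S.metricFeasible α U) (x v : Eucl n)
    {t : ℝ} (ht : 0 ≤ t) : mulE (W x t) (mulE (W x t)⁻¹ v) = v := by
  rw [← mulE_mul, Matrix.mul_nonsing_inv _
    ((Matrix.isUnit_iff_isUnit_det _).1 (isUnit_of_mem_metricFeasible hW x ht)), mulE_one]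

theorem energy_eq (hW : (ω₁, ω₂, W) ∈ S.metricFeasible α U) (x : ℝ → Eucl n)
    {t : ℝ} (ht : 0 ≤ t) :
    energy W x t = inner ℝ (mulE (W (x t) t)⁻¹ (x t))
      (mulE (W (x t) t) (mulE (W (x t) t)⁻¹ (x t))) := by
  rw [mulE_mulE_inv hW _ _ ht, real_inner_comm]
  rfl

theorem mul_sq_norm_le_energy (hW : (ω₁, ω₂, W) ∈ S.metricFeasible α U) (x : ℝ → Eucl n)
    {t : ℝ} (ht : 0 ≤ t) :
    ω₁ * ‖mulE (W (x t) t)⁻¹ (x t)‖ ^ 2 ≤ energy W x t := by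
  have h := (hW.2.2.2 (x t) t ht).2.1.inner_mulE_nonneg (mulE (W (x t) t)⁻¹ (x t))
  rw [mulE_sub_left, mulE_smul_left, mulE_one, inner_sub_right, inner_smul_right,
    real_inner_self_eq_norm_sq, ← energy_eq hW x ht] at h
  linarith

theorem energy_nonneg (hW : (ω₁, ω₂, W) ∈ S.metricFeasible α U) (x : ℝ → Eucl n)
    {t : ℝ} (ht : 0 ≤ t) : 0 ≤ energy W x t :=
  (mul_nonneg hW.1.le (sq_nonneg _)).trans (mul_sq_norm_le_energy hW x ht)

/-- The form of `W` is nonnegative at `y - r x`, where `Wy = x`. Bounding `xᵀWx` by `ω₂‖x‖²` and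
taking the optimal `r = 1/ω₂` gives `‖x‖² ≤ ω₂E`, with no need to invert the order relation `W ⪯
ω₂I`. -/
theorem norm_le_sqrt_energy (hW : (ω₁, ω₂, W) ∈ S.metricFeasible α U) (x : ℝ → Eucl n)
    {t : ℝ} (ht : 0 ≤ t) : ‖x t‖ ≤ √ω₂ * √(energy W x t) := by
  set y := mulE (W (x t) t)⁻¹ (x t) with hy
  have hWy : mulE (W (x t) t) y = x t := mulE_mulE_inv hW _ _ ht
  have hE : energy W x t = inner ℝ (x t) y := rfl
  have hq (r : ℝ) : 0 ≤ energy W x t - 2 * r * ‖x t‖ ^ 2 + r ^ 2 * (ω₂ * ‖x t‖ ^ 2) := by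
    have h1 := (hW.2.2.2 (x t) t ht).1.posSemidef.inner_mulE_nonneg (y - r • x t)
    have h2 := (hW.2.2.2 (x t) t ht).2.2.1.inner_mulE_nonneg (x t)
    have h3 : inner ℝ y (mulE (W (x t) t) (x t)) = ‖x t‖ ^ 2 := by
      rw [← transpose_of_mem_metricFeasible hW _ ht, ← inner_mulE_left, hWy,
        real_inner_self_eq_norm_sq]
    rw [mulE_sub_left, mulE_smul_left, mulE_one, inner_sub_right, inner_smul_right,
      real_inner_self_eq_norm_sq] at h2
    have h4 : mulE (W (x t) t) (y - r • x t) = x t - r • mulE (W (x t) t) (x t) := by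
      rw [← mulEBilin_apply, map_sub, map_smul, mulEBilin_apply, mulEBilin_apply, hWy]
    rw [h4, inner_sub_right, inner_sub_left, inner_sub_left, inner_smul_left, inner_smul_left,
      inner_smul_right, inner_smul_right, h3, real_inner_self_eq_norm_sq, real_inner_comm,
      ← hE] at h1
    simp only [conj_trivial] at h1
    nlinarith [mul_le_mul_of_nonneg_left h2 (sq_nonneg r)]
  have hω₂ : 0 < ω₂ := hW.2.1
  have h := hq ω₂⁻¹
  have h' : ‖x t‖ ^ 2 ≤ ω₂ * energy W x t := by
    have e : energy W x t - 2 * ω₂⁻¹ * ‖x t‖ ^ 2 + ω₂⁻¹ ^ 2 * (ω₂ * ‖x t‖ ^ 2) =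
        energy W x t - ω₂⁻¹ * ‖x t‖ ^ 2 := by
      field_simp
      ring
    rw [e, sub_nonneg, inv_mul_le_iff₀ hω₂] at h
    exact h
  rw [← Real.sqrt_mul hω₂.le]
  exact Real.le_sqrt_of_sq_le h'

theorem hasDerivWithinAt_energy (hW : (ω₁, ω₂, W) ∈ S.metricFeasible α U) {x : ℝ → Eucl n}
    (hx : S.IsClosedLoopSolution W x)
    (hU : ∀ t, 0 ≤ t → U W (x t) t = S.feedback W (x t) t) {t : ℝ} (ht : 0 ≤ t) :
    HasDerivWithinAt (energy W x)
      (2 * inner ℝ (mulE (W (x t) t)⁻¹ (x t)) (S.velocity (S.feedback W) (x t) t) -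
        inner ℝ (mulE (W (x t) t)⁻¹ (x t))
          (mulE (W.dot (S.velocity (U W)) (x t) t) (mulE (W (x t) t)⁻¹ (x t)))) (Ici 0) t := by
  refine hasDerivWithinAt_inner_inv (N := fun s => W (x s) s) (x := x)
    (hW.2.2.1.hasDerivWithinAt_comp ht ?_) (hx t ht) (isUnit_of_mem_metricFeasible hW _ ht)
    (transpose_of_mem_metricFeasible hW _ ht)
  -- The dot is taken along the input law `U W`; it is the derivative along the solution because
  -- that law agrees with the feedback there.
  have : S.velocity (U W) (x t) t = S.velocity (S.feedback W) (x t) t := by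
    simp only [velocity, hU t ht]
  rw [this]
  exact hx t ht

/-- The matrix inequality tested on `y = W⁻¹x` reads `yᵀẆy - 2yᵀAx + 2‖B₁ᵀy‖² ≥ 2αE`. The feedback
contributes exactly `-2‖B₁ᵀy‖²` to `2y·ẋ`, so only `2y·B₂d` is left, handled by Cauchy–Schwarz. -/
theorem energy_deriv_le (hW : (ω₁, ω₂, W) ∈ S.metricFeasible α U) (hb₂ : 0 ≤ b₂)
    (hB₂ : ∀ x t, 0 ≤ t → ‖S.B₂ x t‖ ≤ b₂) (hd : ∀ t, 0 ≤ t → ‖S.d t‖ ≤ dbar)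
    (x : ℝ → Eucl n) {t : ℝ} (ht : 0 ≤ t) :
    2 * inner ℝ (mulE (W (x t) t)⁻¹ (x t)) (S.velocity (S.feedback W) (x t) t) -
        inner ℝ (mulE (W (x t) t)⁻¹ (x t))
          (mulE (W.dot (S.velocity (U W)) (x t) t) (mulE (W (x t) t)⁻¹ (x t))) ≤
      -(2 * α) * energy W x t + 2 * (b₂ * dbar / √ω₁) * √(energy W x t) := by
  have hω₁ : 0 < ω₁ := hW.1
  set y := mulE (W (x t) t)⁻¹ (x t) with hy
  have hWy : mulE (W (x t) t) y = x t := mulE_mulE_inv hW _ _ ht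
  have hp := (hW.2.2.2 (x t) t ht).2.2.2.inner_mulE_nonneg y
  have h1 : inner ℝ y (mulE (W (x t) t) (mulE (S.A (x t) t)ᵀ y)) =
      inner ℝ y (mulE (S.A (x t) t) (x t)) := by
    rw [← transpose_of_mem_metricFeasible hW _ ht, ← inner_mulE_left, hWy, ← inner_mulE_left,
      real_inner_comm]
  simp only [mulE_sub_left, mulE_add_left, mulE_smul_left, mulE_mul, inner_sub_right,
    inner_add_right, inner_smul_right, h1, hWy] at hp
  have hE : energy W x t = inner ℝ y (x t) := by rw [real_inner_comm]; rfl
  rw [← hE] at hp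
  have hv : S.velocity (S.feedback W) (x t) t = mulE (S.A (x t) t) (x t)
      - mulE (S.B₁ (x t) t) (mulE (S.B₁ (x t) t)ᵀ y) + mulE (S.B₂ (x t) t) (S.d t) := by
    simp only [velocity, feedback, mulE_neg_right, ← hy, S.A_mul _ _ ht, sub_eq_add_neg]
  rw [hv, inner_add_right, inner_sub_right]
  have hy' : ‖y‖ ≤ √(energy W x t) / √ω₁ := by
    rw [← Real.sqrt_div' _ hω₁.le]
    refine Real.le_sqrt_of_sq_le ?_
    rw [le_div_iff₀ hω₁]
    linarith [mul_sq_norm_le_energy hW x ht]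
  have hBd : ‖mulE (S.B₂ (x t) t) (S.d t)‖ ≤ b₂ * dbar :=
    (norm_mulE_le _ _).trans (mul_le_mul (hB₂ _ _ ht) (hd t ht) (norm_nonneg _) hb₂)
  have h2 : inner ℝ y (mulE (S.B₂ (x t) t) (S.d t)) ≤ √(energy W x t) / √ω₁ * (b₂ * dbar) :=
    (real_inner_le_norm _ _).trans (mul_le_mul hy' hBd (norm_nonneg _) (by positivity))
  have h3 : √(energy W x t) / √ω₁ * (b₂ * dbar) = b₂ * dbar / √ω₁ * √(energy W x t) := by ring
  linarith

theorem le_of_mem_metricFeasible (hn : 0 < n) (hW : (ω₁, ω₂, W) ∈ S.metricFeasible α U) :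
    ω₁ ≤ ω₂ := by
  have h1 := (hW.2.2.2 0 0 le_rfl).2.1.diag_nonneg (i := ⟨0, hn⟩)
  have h2 := (hW.2.2.2 0 0 le_rfl).2.2.1.diag_nonneg (i := ⟨0, hn⟩)
  simp at h1 h2
  linarith

/-- The norm of a closed-loop solution decays exponentially to a steady-state bound. -/
theorem norm_le_of_isClosedLoopSolution (hn : 0 < n) (hα : 0 < α) (hb₂ : 0 ≤ b₂)
    (hB₂ : ∀ x t, 0 ≤ t → ‖S.B₂ x t‖ ≤ b₂) (hd : ∀ t, 0 ≤ t → ‖S.d t‖ ≤ dbar)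
    (hW : (ω₁, ω₂, W) ∈ S.metricFeasible α U) {x : ℝ → Eucl n}
    (hx : S.IsClosedLoopSolution W x)
    (hU : ∀ t, 0 ≤ t → U W (x t) t = S.feedback W (x t) t) {t : ℝ} (ht : 0 ≤ t) :
    ‖x t‖ ≤ √(energy W x 0) * √ω₂ * Real.exp (-α * t) + b₂ * dbar / α * (ω₂ / ω₁) := by
  have hω₁ : 0 < ω₁ := hW.1
  have hdbar : 0 ≤ dbar := (norm_nonneg _).trans (hd 0 le_rfl)
  have h := sqrt_le_of_hasDerivWithinAt_le hα (by positivity : 0 ≤ b₂ * dbar / √ω₁)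
    (fun s hs => energy_nonneg hW x hs) (fun s hs => hasDerivWithinAt_energy hW hx hU hs)
    (fun s hs => energy_deriv_le hW hb₂ hB₂ hd x hs) ht
  have hχ : 1 ≤ ω₂ / ω₁ := (one_le_div hω₁).2 (le_of_mem_metricFeasible hn hW)
  -- The estimate itself yields the sharper factor `√χ`; it is weakened to `χ` using `χ ≥ 1`.
  have hs : √ω₂ / √ω₁ ≤ ω₂ / ω₁ := by
    rw [← Real.sqrt_div' _ hω₁.le]
    exact Real.sqrt_le_iff.2 ⟨by linarith, by nlinarith⟩
  calc ‖x t‖ ≤ √ω₂ * √(energy W x t) := norm_le_sqrt_energy hW x ht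
    _ ≤ √ω₂ * (√(energy W x 0) * Real.exp (-α * t) + b₂ * dbar / √ω₁ / α) := by gcongr
    _ = √(energy W x 0) * √ω₂ * Real.exp (-α * t) + b₂ * dbar / α * (√ω₂ / √ω₁) := by ring
    _ ≤ _ := by gcongr

theorem sqrt_energy_zero {x : ℝ → Eucl n} {Θ : Matrix (Fin n) (Fin n) ℝ}
    (hΘ : (W (x 0) 0)⁻¹ = Θᵀ * Θ) : √(energy W x 0) = ‖mulE Θ (x 0)‖ := by
  rw [energy, hΘ, mulE_mul, ← inner_mulE_left, real_inner_self_eq_norm_sq,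
    Real.sqrt_sq (norm_nonneg _)]

end ControlSystem

/-! ### Limsup, rescaling equivalence and convexity -/

namespace ControlSystem

variable {n m k : ℕ} {S : ControlSystem n m k} {α b₂ dbar lam : ℝ}
  {U : MetricField n → Eucl n → ℝ → Eucl m} {ω₁ ω₂ ν χ : ℝ} {W V : MetricField n}

theorem limsup_smallestPathIntegral_le (hn : 0 < n) (hα : 0 < α) (hb₂ : 0 ≤ b₂)
    (hB₂ : ∀ x t, 0 ≤ t → ‖S.B₂ x t‖ ≤ b₂) (hd : ∀ t, 0 ≤ t → ‖S.d t‖ ≤ dbar)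
    (hW : (ω₁, ω₂, W) ∈ S.metricFeasible α U) {x : ℝ → Eucl n}
    (hx : S.IsClosedLoopSolution W x)
    (hU : ∀ t, 0 ≤ t → U W (x t) t = S.feedback W (x t) t) :
    limsup (fun t => smallestPathIntegral 1 0 (x t)) atTop ≤ b₂ * dbar / α * (ω₂ / ω₁) := by
  simp only [smallestPathIntegral_zero_left, mulE_one]
  refine le_of_forall_pos_le_add fun ε hε => ?_
  have hlim : Tendsto (fun t => √(energy W x 0) * √ω₂ * Real.exp (-α * t)) atTop (𝓝 0) := by
    have h : Tendsto (fun t : ℝ => Real.exp (-α * t)) atTop (𝓝 0) :=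
      Real.tendsto_exp_atBot.comp (tendsto_id.const_mul_atTop_of_neg (neg_neg_of_pos hα))
    simpa using h.const_mul (√(energy W x 0) * √ω₂)
  -- A real `limsup` is meaningful only with a lower bound on the function, here nonnegativity of
  -- the norm.
  refine limsup_le_of_le (isCoboundedUnder_le_of_le atTop (x := 0) fun t => norm_nonneg _) ?_
  filter_upwards [hlim.eventually_le_const hε, eventually_ge_atTop 0] with t h ht
  linarith [norm_le_of_isClosedLoopSolution hn hα hb₂ hB₂ hd hW hx hU ht]

theorem smul_mem_convexFeasible (hW : (ω₁, ω₂, W) ∈ S.metricFeasible α U) :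
    (1 / ω₁, ω₂ / ω₁, (1 / ω₁) • W) ∈ S.convexFeasible α U := by
  obtain ⟨h₁, h₂, hdiff, h⟩ := hW
  have hr : 0 < 1 / ω₁ := one_div_pos.2 h₁
  refine ⟨hr, hdiff.smul _, fun x t ht => ?_⟩
  obtain ⟨hpd, hlo, hhi, hdot⟩ := h x t ht
  -- Scaling back recovers `W`, so both programs take the dot along the same velocity even when the
  -- input depends on the metric.
  have hsub : (1 / ω₁)⁻¹ • (1 / ω₁) • W = W := inv_smul_smul₀ hr.ne' W
  rw [hsub, MetricField.dot_smul hdiff _ _ _ ht]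
  refine ⟨hpd.smul hr, ?_, ?_, ?_⟩
  · convert hlo.smul hr.le using 1
    simp [smul_sub, smul_smul, h₁.ne']
  · convert hhi.smul hr.le using 1
    simp [smul_sub, smul_smul, div_eq_inv_mul]
  · convert hdot.smul hr.le using 1
    simp only [Pi.smul_apply, Matrix.mul_smul, Matrix.smul_mul]
    module

theorem smul_mem_metricFeasible (hn : 0 < n) (hV : (ν, χ, V) ∈ S.convexFeasible α U) :
    (1 / ν, χ / ν, ν⁻¹ • V) ∈ S.metricFeasible α U := by
  obtain ⟨hν, hdiff, h⟩ := hV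
  have hr : 0 < ν⁻¹ := inv_pos.2 hν
  -- A diagonal entry of `I ⪯ V ⪯ χI` forces `χ ≥ 1`; this needs `n > 0`.
  have hχ : 0 < χ := by
    have h1 := (h 0 0 le_rfl).2.1.diag_nonneg (i := ⟨0, hn⟩)
    have h2 := (h 0 0 le_rfl).2.2.1.diag_nonneg (i := ⟨0, hn⟩)
    simp at h1 h2
    linarith
  refine ⟨one_div_pos.2 hν, div_pos hχ hν, hdiff.smul _, fun x t ht => ?_⟩
  obtain ⟨hpd, hlo, hhi, hdot⟩ := h x t ht
  rw [MetricField.dot_smul hdiff _ _ _ ht]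
  refine ⟨hpd.smul hr, ?_, ?_, ?_⟩
  · convert hlo.smul hr.le using 1
    simp [smul_sub]
  · convert hhi.smul hr.le using 1
    simp [smul_sub, smul_smul, div_eq_inv_mul]
  · convert hdot.smul hr.le using 1
    simp only [Pi.smul_apply, Matrix.mul_smul, Matrix.smul_mul, smul_sub, smul_add, smul_smul,
      smul_neg]
    rw [show ν⁻¹ * (2 * ν) = 2 by field_simp]
    module

theorem smul_mem_convexFeasible_iff (hn : 0 < n) :
    (1 / ω₁, ω₂ / ω₁, (1 / ω₁) • W) ∈ S.convexFeasible α U ↔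
      (ω₁, ω₂, W) ∈ S.metricFeasible α U := by
  refine ⟨fun h => ?_, smul_mem_convexFeasible⟩
  have h₁ : ω₁ ≠ 0 := (one_div_pos.1 h.1).ne'
  simpa [smul_smul, h₁] using smul_mem_metricFeasible hn h

theorem convexCost_smul (ω₁ ω₂ : ℝ) (W : MetricField n) :
    convexCost α b₂ dbar lam (1 / ω₁, ω₂ / ω₁, (1 / ω₁) • W) =
      metricCost α b₂ dbar lam (ω₁, ω₂, W) := rfl

theorem metricCost_smul (hν : ν ≠ 0) (χ : ℝ) (V : MetricField n) :
    metricCost α b₂ dbar lam (1 / ν, χ / ν, ν⁻¹ • V) = convexCost α b₂ dbar lam (ν, χ, V) := by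
  simp [metricCost, convexCost, hν]

theorem optimalValue_metric_eq_convex (hn : 0 < n) :
    optimalValue (metricCost α b₂ dbar lam) (S.metricFeasible α U) =
      optimalValue (convexCost α b₂ dbar lam) (S.convexFeasible α U) := by
  refine le_antisymm (le_iInf₂ ?_) (le_iInf₂ ?_)
  · rintro ⟨ν, χ, V⟩ h
    rw [← metricCost_smul h.1.ne']
    exact iInf₂_le _ (smul_mem_metricFeasible hn h)
  · rintro ⟨ω₁, ω₂, W⟩ h
    rw [← convexCost_smul]
    exact iInf₂_le _ (smul_mem_convexFeasible h)

theorem isOptimal_metric_iff_convex (hn : 0 < n) :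
    IsOptimal (metricCost α b₂ dbar lam) (S.metricFeasible α U) (ω₁, ω₂, W) ↔
      IsOptimal (convexCost α b₂ dbar lam) (S.convexFeasible α U)
        (1 / ω₁, ω₂ / ω₁, (1 / ω₁) • W) := by
  refine and_congr (smul_mem_convexFeasible_iff hn).symm ?_
  rw [convexCost_smul]
  constructor
  · rintro h ⟨ν, χ, V⟩ hq
    rw [← metricCost_smul hq.1.ne']
    exact h _ (smul_mem_metricFeasible hn hq)
  · rintro h ⟨ω₁, ω₂, W⟩ hq
    exact h _ (smul_mem_convexFeasible hq)

theorem isOptimal_convex_iff_metric (hn : 0 < n) :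
    IsOptimal (convexCost α b₂ dbar lam) (S.convexFeasible α U) (ν, χ, V) ↔
      IsOptimal (metricCost α b₂ dbar lam) (S.metricFeasible α U)
        (1 / ν, χ / ν, ν⁻¹ • V) := by
  -- At `ν = 0` both sides fail: `1 / 0 = 0` is not a positive `ω₁`.
  by_cases hν : ν = 0
  · subst hν
    exact iff_of_false (fun h => h.1.1.ne' rfl) (fun h => h.1.1.ne' (by simp))
  · rw [isOptimal_metric_iff_convex hn]
    have e : ((1 : ℝ) / (1 / ν), χ / ν / (1 / ν), ((1 : ℝ) / (1 / ν)) • ν⁻¹ • V) = (ν, χ, V) := by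
      simp [smul_smul, hν]
    rw [e]

theorem convex_convexFeasible (u : Eucl n → ℝ → Eucl m) :
    Convex ℝ (S.convexFeasible α (fun _ => u)) := by
  rintro ⟨ν, χ, V⟩ ⟨hν, hdiff, h⟩ ⟨ν', χ', V'⟩ ⟨hν', hdiff', h'⟩ a b ha hb hab
  change (a • ν + b • ν', a • χ + b • χ', a • V + b • V') ∈ _
  refine ⟨convex_Ioi (0 : ℝ) hν hν' ha hb hab, (hdiff.smul a).add (hdiff'.smul b),
    fun x t ht => ?_⟩
  obtain ⟨-, hlo, hhi, hdot⟩ := h x t ht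
  obtain ⟨-, hlo', hhi', hdot'⟩ := h' x t ht
  have hlo₂ : ((a • V + b • V') x t - 1).PosSemidef := by
    convert (hlo.smul ha).add (hlo'.smul hb) using 1
    -- The constant term `I` is the only one that needs `a + b = 1`; the other matrix inequalities
    -- are homogeneous.
    obtain rfl : b = 1 - a := by linarith
    simp only [Pi.add_apply, Pi.smul_apply]
    module
  refine ⟨?_, hlo₂, ?_, ?_⟩
  -- Write the combination as `I` plus a semidefinite matrix, which avoids treating `a = 0` or `b =
  -- 0` separately.
  · simpa using Matrix.PosDef.one.add_posSemidef hlo₂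
  · convert (hhi.smul ha).add (hhi'.smul hb) using 1
    simp only [Pi.add_apply, Pi.smul_apply, smul_eq_mul]
    module
  · convert (hdot.smul ha).add (hdot'.smul hb) using 1
    rw [MetricField.dot_add (hdiff.smul a) (hdiff'.smul b) _ _ ht,
      MetricField.dot_smul hdiff _ _ _ ht, MetricField.dot_smul hdiff' _ _ _ ht]
    simp only [Pi.add_apply, Pi.smul_apply, Matrix.mul_smul, Matrix.smul_mul, Matrix.mul_add,
      Matrix.add_mul, smul_eq_mul]
    module

theorem convexOn_convexCost (u : Eucl n → ℝ → Eucl m) :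
    ConvexOn ℝ (S.convexFeasible α (fun _ => u)) (convexCost α b₂ dbar lam) := by
  refine ⟨convex_convexFeasible u, ?_⟩
  rintro ⟨ν, χ, V⟩ - ⟨ν', χ', V'⟩ - a b - - -
  refine le_of_eq ?_
  simp only [convexCost, Prod.smul_mk, Prod.mk_add_mk, smul_eq_mul]
  ring

end ControlSystem

theorem corollary1 {n m k : ℕ} (hn : 0 < n) (S : ControlSystem n m k) (α b₂ dbar lam : ℝ)
    (hα : 0 < α) (hb₂ : 0 < b₂) (hB₂ : ∀ x t, 0 ≤ t → ‖S.B₂ x t‖ ≤ b₂)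
    (hd : IsLUB ((fun t => ‖S.d t‖) '' Ici (0 : ℝ)) dbar) (hlam : 0 < lam) :
    (∀ U : MetricField n → Eucl n → ℝ → Eucl m,
      -- the steady-state bound for the closed loop
      (∀ (ω₁ ω₂ : ℝ) (W : MetricField n), (ω₁, ω₂, W) ∈ S.metricFeasible α U →
        ∀ x : ℝ → Eucl n, S.IsClosedLoopSolution W x →
          (∀ t, 0 ≤ t → U W (x t) t = S.feedback W (x t) t) →
          (∀ Θ : Matrix (Fin n) (Fin n) ℝ, (W (x 0) 0)⁻¹ = Θᵀ * Θ → ∀ t, 0 ≤ t →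
            smallestPathIntegral 1 0 (x t) ≤
              smallestPathIntegral Θ 0 (x 0) * √ω₂ * Real.exp (-α * t)
                + b₂ * dbar / α * (ω₂ / ω₁)) ∧
          limsup (fun t => smallestPathIntegral 1 0 (x t)) atTop ≤ b₂ * dbar / α * (ω₂ / ω₁)) ∧
      -- the two programs have the same optimal value
      optimalValue (metricCost α b₂ dbar lam) (S.metricFeasible α U) =
        optimalValue (convexCost α b₂ dbar lam) (S.convexFeasible α U) ∧
      -- and their optimal solutions correspond to each other
      (∀ (ω₁ ω₂ : ℝ) (W : MetricField n),
        IsOptimal (metricCost α b₂ dbar lam) (S.metricFeasible α U) (ω₁, ω₂, W) ↔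
          IsOptimal (convexCost α b₂ dbar lam) (S.convexFeasible α U)
            (1 / ω₁, ω₂ / ω₁, (1 / ω₁) • W)) ∧
      (∀ (ν χ : ℝ) (V : MetricField n),
        IsOptimal (convexCost α b₂ dbar lam) (S.convexFeasible α U) (ν, χ, V) ↔
          IsOptimal (metricCost α b₂ dbar lam) (S.metricFeasible α U) (1 / ν, χ / ν, ν⁻¹ • V))) ∧
    -- the second program is convex
    (∀ u : Eucl n → ℝ → Eucl m,
      ConvexOn ℝ (S.convexFeasible α (fun _ => u)) (convexCost α b₂ dbar lam)) := by
  have hd' : ∀ t, 0 ≤ t → ‖S.d t‖ ≤ dbar := fun t ht => hd.1 ⟨t, ht, rfl⟩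
  refine ⟨fun U => ⟨fun ω₁ ω₂ W hW x hx hU => ⟨fun Θ hΘ t ht => ?_, ?_⟩,
    ControlSystem.optimalValue_metric_eq_convex hn,
    fun _ _ _ => ControlSystem.isOptimal_metric_iff_convex hn,
    fun _ _ _ => ControlSystem.isOptimal_convex_iff_metric hn⟩,
    fun u => ControlSystem.convexOn_convexCost u⟩
  · rw [smallestPathIntegral_zero_left, smallestPathIntegral_zero_left, mulE_one,
      ← ControlSystem.sqrt_energy_zero hΘ]
    exact ControlSystem.norm_le_of_isClosedLoopSolution hn hα hb₂.le hB₂ hd' hW hx hU ht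
  · exact ControlSystem.limsup_smallestPathIntegral_le hn hα hb₂.le hB₂ hd' hW hx hU
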